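/- Let $k$ be a field complete with respect to a non-Archimedean absolute value $|\cdot|$ such that $|k|$ is dense in $\mathbb{R}_{\ge 0}$. A Banach $k$-vector space is a complete normed $k$-vector space whose norm satisfies the strong triangle inequality, and $\cong$ denotes isometric $k$-linear isomorphism. For a family $\mathcal{W} = (\mathcal{W}(i))_{i \in I}$ of Banach $k$-vector spaces, let $\Pi_I \mathcal{W}$ be the space of all $w \in \prod_{i \in I} \mathcal{W}(i)$ with $\|w\| := \sup_i \|w(i)\| < \infty$, with this norm, and let $\Sigma_I \mathcal{W}$ be its closed subspace of those $w$ such that $\{i \in I : \|w(i)\| \ge \epsilon\}$ is finite for every $\epsilon > 0$. For a cardinal $\kappa$, define classes $\mathrm{P}\Pi_{\alpha}$, $\mathrm{P}\Sigma_{\alpha}$ of Banach $k$-vector spaces by recursion on the ordinal $\alpha$, writing $\mathrm{P}\Pi_{<\alpha} = \bigcup_{\gamma<\alpha} \mathrm{P}\Pi_\gamma$ and $\mathrm{P}\Sigma_{<\alpha} = \bigcup_{\gamma<\alpha} \mathrm{P}\Sigma_\gamma$. The classes $\mathrm{P}\Pi_0 = \mathrm{P}\Sigma_0$ consist of the spaces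 isomorphic to $k$. For $\alpha \neq 0$, $\mathrm{P}\Pi_\alpha$ (resp. $\mathrm{P}\Sigma_\alpha$) consists of the spaces isomorphic to $\Pi_I \mathcal{W}$ (resp. $\Sigma_I \mathcal{W}$) for some set $I$ with $\# I < \kappa$ and some family $\mathcal{W}$ of members of $\mathrm{P}\Pi_{<\alpha} \cup \mathrm{P}\Sigma_{<\alpha}$ indexed by $I$ such that for every $\beta < \alpha$ there are infinitely many $i \in I$ with $\mathcal{W}(i) \in \mathrm{P}\Sigma_{<\alpha} \setminus \mathrm{P}\Sigma_{<\beta}$ (resp. $\mathcal{W}(i) \in \mathrm{P}\Pi_{<\alpha} \setminus \mathrm{P}\Pi_{<\beta}$). If $\kappa$ is instead the class of all cardinals, $\mathrm{P}\Pi_\alpha$ and $\mathrm{P}\Sigma_\alpha$ denote the unions over all cardinals of the classes just defined. A Banach $k$-vector space $W$ is a reductive summand of a Banach $k$-vector space $V$ if there are bounded $k$-linear maps $\sigma \colon W \to V$ and $\pi \colon V \to W$ of operator norm at most $1$ with $\|\mathrm{id}_W - \pi \circ \sigma\| < 1$. Let $\kappa$ be an infinite cardinal or the class of all cardinals, and suppose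 that no set of cardinality less than $\kappa$ (no set at all, if $\kappa$ is the class of all cardinals) is $\omega_1$-measurable, where a set is $\omega_1$-measurable if it is uncountable and admits a non-principal ultrafilter closed under countable intersections. Let $\alpha, \beta$ be non-zero ordinals, $V \in \mathrm{P}\Pi_\alpha$ and $W \in \mathrm{P}\Sigma_\beta$. Then: (1) if $W$ is a reductive summand of $V$, then $\beta < \alpha$; (2) if $V$ is a reductive summand of $W$, then $\alpha < \beta$. -/

import Mathlib

open Cardinal
open scoped ENNReal NNReal

universe u

/-- A Banach `k`-vector space over a complete non-Archimedean valuation field `k`: a complete normed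
`k`-vector space whose norm satisfies the strong triangle inequality. -/
structure Ban (k : Type u) [NontriviallyNormedField k] : Type (u + 1) where
  carrier : Type u
  [normed : NormedAddCommGroup carrier]
  [space : NormedSpace k carrier]
  [complete : CompleteSpace carrier]
  [ultrametric : IsUltrametricDist carrier]

namespace Ban

section

variable {k : Type u} [NontriviallyNormedField k]

instance : CoeSort (Ban k) (Type u) := ⟨Ban.carrier⟩

instance (V : Ban k) : NormedAddCommGroup V := V.normed
instance (V : Ban k) : NormedSpace k V := V.space
instance (V : Ban k) : CompleteSpace V := V.complete
instance (V : Ban k) : IsUltrametricDist V := V.ultrametric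

/-- Isomorphism of Banach `k`-vector spaces: isometric `k`-linear isomorphism. -/
def Iso (V W : Ban k) : Prop := Nonempty (V ≃ₗᵢ[k] W)

/-- The base field, as a Banach space over itself. -/
def base (k : Type u) [NontriviallyNormedField k] [CompleteSpace k] [IsUltrametricDist k] :
    Ban k where
  carrier := k

theorem isUltrametricDist_lp {I : Type u} (W : I → Ban k) :
    IsUltrametricDist (lp (fun i => (W i : Type u)) ∞) := by
  refine IsUltrametricDist.isUltrametricDist_of_forall_norm_add_le_max_norm fun x y => ?_
  refine lp.norm_le_of_forall_le (le_max_of_le_left (norm_nonneg _)) fun i => ?_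
  refine (IsUltrametricDist.norm_add_le_max (x i) (y i)).trans ?_
  exact max_le_max (lp.norm_apply_le_norm ENNReal.top_ne_zero x i)
    (lp.norm_apply_le_norm ENNReal.top_ne_zero y i)

/-- The bounded direct product `Π_I W`: bounded families with the supremum norm. -/
noncomputable def boundedProd {I : Type u} (W : I → Ban k) : Ban k where
  carrier := lp (fun i => (W i : Type u)) ∞
  ultrametric := isUltrametricDist_lp W

/-- The families `w` in the bounded direct product such that for every `ε > 0` only finitely many
indices `i` satisfy `ε ≤ ‖w i‖`. -/
noncomputable def vanishing {I : Type u} (W : I → Ban k) :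
    Submodule k (lp (fun i => (W i : Type u)) ∞) where
  carrier := {w | ∀ ε : ℝ, 0 < ε → {i | ε ≤ ‖w i‖}.Finite}
  zero_mem' := by
    intro ε hε
    have : {i | ε ≤ ‖(0 : lp (fun i => (W i : Type u)) ∞) i‖} = ∅ := by
      ext i
      simpa using hε
    rw [this]
    exact Set.finite_empty
  add_mem' := by
    intro x y hx hy ε hε
    refine ((hx ε hε).union (hy ε hε)).subset fun i hi => ?_
    have h : ε ≤ max ‖x i‖ ‖y i‖ :=
      le_trans hi (IsUltrametricDist.norm_add_le_max (x i) (y i))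
    exact le_max_iff.mp h
  smul_mem' := by
    intro c x hx ε hε
    by_cases hc : c = 0
    · subst hc
      have : {i | ε ≤ ‖((0 : k) • x) i‖} = ∅ := by
        ext i
        simpa using hε
      rw [this]
      exact Set.finite_empty
    · have hc' : 0 < ‖c‖ := norm_pos_iff.mpr hc
      refine (hx (ε / ‖c‖) (div_pos hε hc')).subset fun i hi => ?_
      have h : ε ≤ ‖c • x i‖ := hi
      rw [norm_smul, mul_comm] at h
      exact (div_le_iff₀ hc').mpr h

theorem isClosed_vanishing {I : Type u} (W : I → Ban k) :
    IsClosed (vanishing W : Set (lp (fun i => (W i : Type u)) ∞)) := by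
  refine isClosed_of_closure_subset fun x hx ε hε => ?_
  obtain ⟨y, hy, hxy⟩ := Metric.mem_closure_iff.mp hx (ε / 2) (half_pos hε)
  refine (hy (ε / 2) (half_pos hε)).subset fun i hi => ?_
  have h1 : ‖(x - y) i‖ ≤ ‖x - y‖ := lp.norm_apply_le_norm ENNReal.top_ne_zero (x - y) i
  rw [dist_eq_norm] at hxy
  have h2 : ‖x i‖ ≤ ‖(x - y) i‖ + ‖y i‖ := by
    simpa using norm_add_le ((x - y) i) (y i)
  have h3 : ε ≤ ‖x i‖ := hi
  change ε / 2 ≤ ‖y i‖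
  linarith

/-- The completed direct sum `Σ_I W`: the closed subspace of the bounded direct product consisting
of the families that vanish at infinity. -/
noncomputable def completedSum {I : Type u} (W : I → Ban k) : Ban k where
  carrier := vanishing W
  complete := (isClosed_vanishing W).completeSpace_coe
  ultrametric :=
    haveI := isUltrametricDist_lp W
    IsUltrametricDist.subtype _

/-- `W` is a reductive summand of `V`: there are `k`-linear maps `σ : W → V`, `π : V → W` of
operator norm at most `1` (a factorisation pair) with `‖id - π ∘ σ‖ < 1`. -/
def IsReductiveSummand (W V : Ban k) : Prop :=
  ∃ (σ : W →L[k] V) (π : V →L[k] W),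
    ‖σ‖ ≤ 1 ∧ ‖π‖ ≤ 1 ∧ ‖ContinuousLinearMap.id k W - π.comp σ‖ < 1

end

end Ban

/-- The two symbols `Π` and `Σ`. -/
inductive ReidSymbol
  | pi
  | sigma

namespace ReidSymbol

/-- Exchange of `Π` and `Σ`. -/
def dual : ReidSymbol → ReidSymbol
  | pi => sigma
  | sigma => pi

/-- The operation denoted by the symbol: bounded direct product or completed direct sum. -/
noncomputable def apply {k : Type u} [NontriviallyNormedField k] (A : ReidSymbol) {I : Type u}
    (W : I → Ban k) : Ban k :=
  match A with
  | pi => Ban.boundedProd W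
  | sigma => Ban.completedSum W

end ReidSymbol

section

variable {k : Type u} [NontriviallyNormedField k] [CompleteSpace k] [IsUltrametricDist k]

/-- The stages of the pure Reid hierarchy for a cardinal `κ`: `PureStage κ α .pi` and
`PureStage κ α .sigma` are the classes `PΠ_α` and `PΣ_α`, both closed under isomorphism.

At `α = 0` both consist of the spaces isomorphic to `k`. For `α ≠ 0` and `A` one of `Π`, `Σ`, with
`B` the other one, `PA_α` consists of the spaces isomorphic to `A_I W`, where `I` is a set of
cardinality less than `κ`, each `W i` lies in `PΠ_γ ∪ PΣ_γ` for some `γ < α`, and for every `β < α`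
there are infinitely many `i` such that `W i` lies in `PB_γ` for some `γ < α` but for no `γ < β`. -/
def PureStage (κ : Cardinal.{u}) (α : Ordinal.{u}) (A : ReidSymbol) (V : Ban k) : Prop :=
  (α = 0 ∧ V.Iso (Ban.base k)) ∨
  (α ≠ 0 ∧ ∃ (I : Type u) (W : I → Ban k), #I < κ ∧
    (∀ i, ∃ γ, ∃ _ : γ < α, ∃ C : ReidSymbol, PureStage κ γ C (W i)) ∧
    (∀ β, ∀ _ : β < α,
      {i | (∃ γ, ∃ _ : γ < α, PureStage κ γ A.dual (W i)) ∧
        ¬ ∃ γ, ∃ _ : γ < β, PureStage κ γ A.dual (W i)}.Infinite) ∧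
    V.Iso (A.apply W))
termination_by α
decreasing_by
  · assumption
  · assumption
  · exact lt_trans ‹_› ‹_›

/-- The pure Reid hierarchy with respect to `κ`, which is a cardinal or the class of all cardinals
(written `⊤`); in the latter case the classes are the unions over all cardinals. -/
def PureClass (A : ReidSymbol) (κ : WithTop Cardinal.{u}) (α : Ordinal.{u}) (V : Ban k) : Prop :=
  ∃ μ : Cardinal.{u}, (κ = μ ∨ κ = ⊤) ∧ PureStage μ α A V

/-- The class `PΠ_α` with respect to `κ`. -/
def PPi (κ : WithTop Cardinal.{u}) (α : Ordinal.{u}) (V : Ban k) : Prop :=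
  PureClass .pi κ α V

/-- The class `PΣ_α` with respect to `κ`. -/
def PSig (κ : WithTop Cardinal.{u}) (α : Ordinal.{u}) (V : Ban k) : Prop :=
  PureClass .sigma κ α V

end

/-- A set `X` is `c`-measurable if it is uncountable and admits a `c`-complete non-principal
ultrafilter. -/
def IsMeasurableSize (c : Cardinal.{u}) (X : Type u) : Prop :=
  Uncountable X ∧
    ∃ F : Ultrafilter X, CardinalInterFilter (F : Filter X) c ∧ ∀ x : X, F ≠ pure x

/-- The non-measurability condition on `κ` (a cardinal, or `⊤` for the class of all cardinals):
no set of size less than `κ` is `ω₁`-measurable. -/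
def NonMeasurabilityCondition (κ : WithTop Cardinal.{u}) : Prop :=
  ∀ X : Type u, ((#X : Cardinal.{u}) : WithTop Cardinal.{u}) < κ → ¬ IsMeasurableSize ℵ₁ X

/-! Everything rests on a lemma of Chase type, `exists_norm_cut_comp_cut_le`: over a non-measurable
index set, an operator from a Π to a Σ becomes small once finitely many factors and finitely many
summands are discarded. Iterated through the hierarchy, it shows that a contraction from a space of
`PΠ_γ`, `γ ≠ 0`, to a Σ, with finitely many summands cut away, is up to an error of norm less than
`1` a finite sum of operators factoring through spaces of `PΣ_{<γ}`
(`exists_cut_comp_mem_nearFactor`). The mirror statement is `exists_comp_cut_mem_nearFactor`.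

Let `X` be in stage `α` of one type `A`. If the claimed inequality failed, the identity of `X` would
factor, up to norm less than `1`, through a space of the dual type of stage at most `α`. The
iterated Chase lemma trades this for spaces of type `A` of stage below `α`, at the cost of cutting
finitely many coordinates of `X`. Only finitely many spaces occur, so their stages are bounded by
some `γ < α`. But infinitely many coordinates of `X` are of the dual type and of a stage at least
`γ`. Such a coordinate, if it survives the cut, inherits a factorisation of its own identity through
type `A` in stages at most `γ`, which induction on the stage, with Π and Σ exchanged, forbids when
its stage is non-zero.

What remains is `γ = 0` with infinitely many surviving coordinates isomorphic to `k`. There a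
finite-rank operator would lie at distance less than `1` from the identity of an
infinite-dimensional space, which is impossible (`cut_notMem_nearFactor_zero`). -/

/-! ### Ideals of sets on an index set of non-measurable size -/

/-- If every non-null set split into two non-null pieces, splitting off pieces forever would give a
decreasing sequence whose successive differences are all non-null. Subtracting the intersection
gives a sequence decreasing to the empty set, so `small` makes one of those differences null. -/
theorem exists_minimal_positive_set {I : Type u} (N : Set I → Prop)
    (mono : ∀ {A B}, A ⊆ B → N B → N A)
    (small : ∀ B : ℕ → Set I, Antitone B → ⋂ m, B m = ∅ → ∃ m, N (B m))
    (huniv : ¬ N Set.univ) :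
    ∃ A, ¬ N A ∧ ∀ B ⊆ A, N B ∨ N (A \ B) := by
  by_contra! h
  choose! f hf using h
  let A : ℕ → Set I := fun n => Nat.rec Set.univ (fun _ A => A \ f A) n
  have hpos : ∀ n, ¬ N (A n) := by
    intro n
    induction n with
    | zero => exact huniv
    | succ n ih => exact (hf _ ih).2.2
  have hanti : Antitone A := antitone_nat_of_succ_le fun n => Set.sdiff_subset
  obtain ⟨m, hm⟩ := small (fun n => A n \ ⋂ l, A l)
    (fun a b hab => Set.sdiff_subset_sdiff_left (hanti hab)) (by
      ext x
      simp only [Set.mem_iInter, Set.mem_sdiff, Set.mem_empty_iff_false, iff_false]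
      intro hx
      exact (hx 0).2 fun l => (hx l).1)
  refine (hf _ (hpos m)).2.1 (mono ?_ hm)
  intro x hx
  refine ⟨(hf _ (hpos m)).1 hx, fun hx' => ?_⟩
  exact (Set.mem_iInter.mp hx' (m + 1)).2 hx

/-- On an index set which is not `ω₁`-measurable, an ideal of sets containing the singletons and a
member of each decreasing sequence of sets with empty intersection is improper. -/
theorem ideal_univ_of_not_isMeasurableSize {I : Type u} (hI : ¬ IsMeasurableSize ℵ₁ I)
    (N : Set I → Prop)
    (mono : ∀ {A B}, A ⊆ B → N B → N A)
    (union : ∀ {A B}, N A → N B → N (A ∪ B))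
    (single : ∀ x, N {x})
    (small : ∀ B : ℕ → Set I, Antitone B → ⋂ m, B m = ∅ → ∃ m, N (B m)) :
    N Set.univ := by
  by_contra huniv
  obtain ⟨A, hA, hsplit⟩ := exists_minimal_positive_set N mono small huniv
  have hempty : N ∅ := by
    obtain ⟨m, hm⟩ := small (fun _ => ∅) (fun _ _ _ => le_rfl) (Set.iInter_const _)
    exact hm
  -- Finite intersections are handled by `union`. The excess of the finite intersections over the
  -- full one decreases to the empty set, so `small` disposes of it.
  have hcountable : ∀ B : ℕ → Set I, (∀ n, N (A \ B n)) → N (A \ ⋂ n, B n) := by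
    intro B hB
    have hfin : ∀ m, N (A \ ⋂ n, ⋂ _ : n < m, B n) := by
      intro m
      induction m with
      | zero => simpa using hempty
      | succ m ih =>
        refine mono ?_ (union ih (hB m))
        intro x hx
        by_contra hx'
        simp only [Set.mem_union, Set.mem_sdiff, Set.mem_iInter, not_or, not_and, not_not] at hx hx'
        refine hx.2 fun n hn => ?_
        rcases Nat.lt_succ_iff_lt_or_eq.mp hn with h | h
        · exact hx'.1 hx.1 n h
        · exact h ▸ hx'.2 hx.1
    obtain ⟨m, hm⟩ := small (fun m => (⋂ n, ⋂ _ : n < m, B n) \ ⋂ n, B n)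
      (by
        intro a b hab x hx
        simp only [Set.mem_sdiff, Set.mem_iInter] at hx ⊢
        exact ⟨fun n hn => hx.1 n (hn.trans_le hab), hx.2⟩)
      (by
        ext x
        simp only [Set.mem_iInter, Set.mem_sdiff, Set.mem_empty_iff_false, iff_false]
        intro hx
        exact (hx 0).2 fun l => (hx (l + 1)).1 l (Nat.lt_succ_self l))
    refine mono ?_ (union (hfin m) hm)
    intro x hx
    by_cases h : x ∈ ⋂ n, ⋂ _ : n < m, B n
    · exact Or.inr ⟨h, hx.2⟩
    · exact Or.inl ⟨hx.1, h⟩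
  -- Relative to the unsplittable set `A`, the sets with null complement form an ultrafilter; it is
  -- countably complete and non-principal, contrary to `hI`.
  let F : Filter I :=
    { sets := {B | N (A \ B)}
      univ_sets := by simpa using hempty
      sets_of_superset := fun h h' => mono (Set.sdiff_subset_sdiff_right h') h
      inter_sets := fun {B C} h h' => by
        simpa only [Set.mem_ofPred_eq, Set.sdiff_inter] using union h h' }
  have hF : ∀ B, B ∈ F ↔ N (A \ B) := fun B => Iff.rfl
  have hultra : ∀ B, Bᶜ ∉ F ↔ B ∈ F := by
    intro B
    have h1 : A \ Bᶜ = A ∩ B := by ext; simp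
    have h2 : A \ (A ∩ B) = A \ B := Set.sdiff_self_inter
    rw [hF, hF, h1]
    have := hsplit (A ∩ B) Set.inter_subset_left
    rw [h2] at this
    refine ⟨fun h => this.resolve_left h, fun h h' => hA ?_⟩
    refine mono ?_ (union h h')
    intro x hx
    by_cases hxB : x ∈ B
    · exact Or.inr ⟨hx, hxB⟩
    · exact Or.inl ⟨hx, hxB⟩
  have hcomplete : CountableInterFilter F := by
    refine ⟨fun S hS hmem => ?_⟩
    rcases S.eq_empty_or_nonempty with rfl | hne
    · simp
    · obtain ⟨B, rfl⟩ := hS.exists_eq_range hne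
      rw [hF, Set.sInter_range]
      exact hcountable B fun n => hmem _ ⟨n, rfl⟩
  have hcompl : ∀ x : I, ({x}ᶜ : Set I) ∈ F := by
    intro x
    rw [hF]
    exact mono (fun y hy => by simpa using hy.2) (single x)
  refine hI ⟨?_, Ultrafilter.ofComplNotMemIff F hultra,
    cardinalInterFilter_aleph_one_iff.mpr hcomplete, fun x hx => ?_⟩
  · by_contra hc
    rw [not_uncountable_iff] at hc
    have h : (⋂ x : I, ({x}ᶜ : Set I)) ∈ F := countable_iInter_mem.mpr hcompl
    have h' : (⋂ x : I, ({x}ᶜ : Set I)) = ∅ := by ext; simp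
    rw [h', hF, Set.sdiff_empty] at h
    exact hA h
  · have h : ({x}ᶜ : Set I) ∈ (pure x : Ultrafilter I) := hx ▸ hcompl x
    simp at h

/-! ### Contractions of ultrametric spaces -/

section

variable {k : Type u} [NontriviallyNormedField k]

namespace ContinuousLinearMap

/-- The strong triangle inequality passes to operators, so cuts stay contractions and sums of errors
of norm less than `1` keep norm less than `1`. -/
theorem opNorm_add_le_max {X Y : Ban k} (S T : X →L[k] Y) : ‖S + T‖ ≤ max ‖S‖ ‖T‖ := by
  refine opNorm_le_bound _ (le_max_of_le_left (norm_nonneg _)) fun x => ?_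
  refine (IsUltrametricDist.norm_add_le_max (S x) (T x)).trans (max_le ?_ ?_)
  · exact (S.le_opNorm x).trans (by gcongr; exact le_max_left _ _)
  · exact (T.le_opNorm x).trans (by gcongr; exact le_max_right _ _)

theorem opNorm_sub_le_max {X Y : Ban k} (S T : X →L[k] Y) : ‖S - T‖ ≤ max ‖S‖ ‖T‖ := by
  simpa [sub_eq_add_neg] using opNorm_add_le_max S (-T)

theorem opNorm_sum_le {X Y : Ban k} {ι : Type*} (S : Finset ι) (T : ι → X →L[k] Y) {C : ℝ}
    (hC : 0 ≤ C) (h : ∀ i ∈ S, ‖T i‖ ≤ C) : ‖∑ i ∈ S, T i‖ ≤ C := by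
  classical
  induction S using Finset.induction_on with
  | empty => simpa using hC
  | insert i S hi ih =>
    rw [Finset.sum_insert hi]
    exact (opNorm_add_le_max _ _).trans (max_le (h i (Finset.mem_insert_self _ _))
      (ih fun j hj => h j (Finset.mem_insert_of_mem hj)))

theorem norm_comp_le_one {X Y Z : Ban k} {g : Y →L[k] Z} {f : X →L[k] Y} (hg : ‖g‖ ≤ 1)
    (hf : ‖f‖ ≤ 1) : ‖g.comp f‖ ≤ 1 :=
  (opNorm_comp_le g f).trans (mul_le_one₀ hg (norm_nonneg _) hf)

theorem norm_apply_le_of_norm_le_one {X Y : Ban k} {f : X →L[k] Y} (hf : ‖f‖ ≤ 1) (x : X) :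
    ‖f x‖ ≤ ‖x‖ :=
  (f.le_opNorm x).trans (mul_le_of_le_one_left (norm_nonneg _) hf)

end ContinuousLinearMap

/-! ### Coordinates of bounded direct products and completed direct sums -/

namespace Ban

variable {I : Type u} (W : I → Ban k)

/-- The `i`-th coordinate of the bounded direct product. -/
noncomputable def prodCoord (i : I) : boundedProd W →L[k] W i :=
  LinearMap.mkContinuous (E := lp (fun i => (W i : Type u)) ∞)
    { toFun := fun x => x i
      map_add' := fun _ _ => rfl
      map_smul' := fun _ _ => rfl } 1
    fun x => (lp.norm_apply_le_norm ENNReal.top_ne_zero x i).trans_eq (one_mul _).symm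

theorem norm_prodCoord_le_one (i : I) : ‖prodCoord W i‖ ≤ 1 :=
  LinearMap.mkContinuous_norm_le _ zero_le_one _

theorem norm_le_of_prodCoord_le {x : boundedProd W} {C : ℝ} (hC : 0 ≤ C)
    (h : ∀ i, ‖prodCoord W i x‖ ≤ C) : ‖x‖ ≤ C :=
  lp.norm_le_of_forall_le hC h

theorem exists_prodCoord_eq (f : ∀ i, W i) {C : ℝ} (h : ∀ i, ‖f i‖ ≤ C) :
    ∃ x : boundedProd W, ∀ i, prodCoord W i x = f i :=
  ⟨(⟨f, memℓp_infty ⟨C, by rintro _ ⟨i, rfl⟩; exact h i⟩⟩ : lp (fun i => (W i : Type u)) ∞),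
    fun _ => rfl⟩

open Classical in
/-- The inclusion of the `i`-th factor into the bounded direct product. -/
noncomputable def prodSingle (i : I) : W i →L[k] boundedProd W :=
  LinearMap.mkContinuous (F := lp (fun i => (W i : Type u)) ∞)
    (lp.lsingle (𝕜 := k) (E := fun i => (W i : Type u)) ∞ i) 1 fun x => by
    refine lp.norm_le_of_forall_le (by positivity) fun j => ?_
    change ‖(Pi.single i x : ∀ i, W i) j‖ ≤ _
    rcases eq_or_ne j i with rfl | h
    · simp
    · simp [Pi.single_eq_of_ne h]

theorem norm_prodSingle_le_one (i : I) : ‖prodSingle W i‖ ≤ 1 :=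
  LinearMap.mkContinuous_norm_le _ zero_le_one _

/-- The inclusion of the completed direct sum into the bounded direct product. -/
noncomputable def sumIncl : completedSum W →L[k] boundedProd W := (vanishing W).subtypeL

theorem norm_sumIncl (x : completedSum W) : ‖sumIncl W x‖ = ‖x‖ := rfl

theorem finite_le_norm_coord (x : completedSum W) {ε : ℝ} (hε : 0 < ε) :
    {i | ε ≤ ‖prodCoord W i (sumIncl W x)‖}.Finite := x.2 ε hε

theorem prodSingle_mem_vanishing (i : I) (x : W i) : prodSingle W i x ∈ vanishing W := by
  classical
  intro ε hε
  refine (Set.finite_singleton i).subset fun j hj => ?_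
  by_contra hji
  have h : ε ≤ ‖(Pi.single i x : ∀ i, W i) j‖ := hj
  rw [Pi.single_eq_of_ne hji, norm_zero] at h
  exact hε.not_ge h

/-- The inclusion of the `i`-th factor into the completed direct sum. -/
noncomputable def sumSingle (i : I) : W i →L[k] completedSum W :=
  (prodSingle W i).codRestrict (vanishing W) (prodSingle_mem_vanishing W i)

theorem sumIncl_sumSingle (i : I) (x : W i) :
    sumIncl W (sumSingle W i x) = prodSingle W i x := rfl

end Ban

namespace ReidSymbol

variable {I : Type u} (A : ReidSymbol) (W : I → Ban k)

/-- The `i`-th coordinate of the bounded direct product or completed direct sum. -/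
noncomputable def coord (i : I) : A.apply W →L[k] W i :=
  match A with
  | pi => Ban.prodCoord W i
  | sigma => (Ban.prodCoord W i).comp (Ban.sumIncl W)

/-- The inclusion of the `i`-th factor into the bounded direct product or completed direct sum. -/
noncomputable def single (i : I) : W i →L[k] A.apply W :=
  match A with
  | pi => Ban.prodSingle W i
  | sigma => Ban.sumSingle W i

theorem norm_coord_le_one (i : I) : ‖A.coord W i‖ ≤ 1 := by
  cases A with
  | pi => exact Ban.norm_prodCoord_le_one W i
  | sigma =>
    refine ContinuousLinearMap.norm_comp_le_one (Ban.norm_prodCoord_le_one W i) ?_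
    exact ContinuousLinearMap.opNorm_le_bound _ zero_le_one fun x => by
      rw [Ban.norm_sumIncl, one_mul]

theorem norm_single_le_one (i : I) : ‖A.single W i‖ ≤ 1 := by
  cases A with
  | pi => exact Ban.norm_prodSingle_le_one W i
  | sigma =>
    refine ContinuousLinearMap.opNorm_le_bound _ zero_le_one fun x => ?_
    change ‖Ban.sumSingle W i x‖ ≤ _
    rw [← Ban.norm_sumIncl, Ban.sumIncl_sumSingle]
    exact ContinuousLinearMap.le_of_opNorm_le _ (Ban.norm_prodSingle_le_one W i) x

theorem norm_le_of_coord_le {x : A.apply W} {C : ℝ} (hC : 0 ≤ C)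
    (h : ∀ i, ‖A.coord W i x‖ ≤ C) : ‖x‖ ≤ C := by
  cases A with
  | pi => exact Ban.norm_le_of_prodCoord_le W hC h
  | sigma => exact Ban.norm_le_of_prodCoord_le W (x := Ban.sumIncl W x) hC h

theorem ext {x y : A.apply W} (h : ∀ i, A.coord W i x = A.coord W i y) : x = y := by
  rw [← sub_eq_zero, ← norm_le_zero_iff]
  refine A.norm_le_of_coord_le W le_rfl fun i => ?_
  simp [h i]

open Classical in
theorem coord_single (i j : I) (x : W i) :
    A.coord W j (A.single W i x) = (Pi.single i x : ∀ i, W i) j := by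
  cases A <;> rfl

theorem coord_single_self (i : I) (x : W i) : A.coord W i (A.single W i x) = x := by
  classical
  rw [coord_single, Pi.single_eq_same]

theorem coord_single_of_ne {i j : I} (h : j ≠ i) (x : W i) :
    A.coord W j (A.single W i x) = 0 := by
  classical
  rw [coord_single, Pi.single_eq_of_ne h]

/-- The operator annihilating the coordinates in a finite set. -/
noncomputable def cut (S : Finset I) : A.apply W →L[k] A.apply W :=
  ContinuousLinearMap.id k _ - ∑ i ∈ S, (A.single W i).comp (A.coord W i)

theorem coord_cut (S : Finset I) (i : I) (x : A.apply W) :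
    A.coord W i (A.cut W S x) =
      A.coord W i x - ∑ j ∈ S, A.coord W i (A.single W j (A.coord W j x)) := by
  simp [cut]

theorem coord_cut_of_mem {S : Finset I} {i : I} (hi : i ∈ S) (x : A.apply W) :
    A.coord W i (A.cut W S x) = 0 := by
  rw [coord_cut, Finset.sum_eq_single_of_mem i hi fun j _ hji => A.coord_single_of_ne W hji.symm _,
    coord_single_self, sub_self]

theorem coord_cut_of_notMem {S : Finset I} {i : I} (hi : i ∉ S) (x : A.apply W) :
    A.coord W i (A.cut W S x) = A.coord W i x := by
  rw [coord_cut, Finset.sum_eq_zero fun j hj => A.coord_single_of_ne W (ne_of_mem_of_not_mem hj hi).symm _,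
    sub_zero]

theorem norm_cut_le_one (S : Finset I) : ‖A.cut W S‖ ≤ 1 := by
  refine (ContinuousLinearMap.opNorm_sub_le_max _ _).trans
    (max_le ContinuousLinearMap.norm_id_le ?_)
  exact ContinuousLinearMap.opNorm_sum_le _ _ zero_le_one fun i _ =>
    ContinuousLinearMap.norm_comp_le_one (A.norm_single_le_one W i) (A.norm_coord_le_one W i)

theorem cut_comp_cut {S T : Finset I} (h : S ⊆ T) :
    (A.cut W T).comp (A.cut W S) = A.cut W T := by
  ext1 x
  refine A.ext W fun i => ?_
  rw [ContinuousLinearMap.comp_apply]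
  by_cases hi : i ∈ T
  · rw [coord_cut_of_mem _ _ hi, coord_cut_of_mem _ _ hi]
  · rw [coord_cut_of_notMem _ _ hi, coord_cut_of_notMem _ _ hi,
      coord_cut_of_notMem _ _ fun hiS => hi (h hiS)]

theorem cut_comp_cut' {S T : Finset I} (h : S ⊆ T) :
    (A.cut W S).comp (A.cut W T) = A.cut W T := by
  ext1 x
  refine A.ext W fun i => ?_
  rw [ContinuousLinearMap.comp_apply]
  by_cases hi : i ∈ S
  · rw [coord_cut_of_mem _ _ hi, coord_cut_of_mem _ _ (h hi)]
  · rw [coord_cut_of_notMem _ _ hi]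

theorem coord_comp_cut_comp_single {S : Finset I} {i : I} (hi : i ∉ S) :
    (A.coord W i).comp ((A.cut W S).comp (A.single W i)) = ContinuousLinearMap.id k (W i) := by
  ext x
  simp [coord_cut_of_notMem _ _ hi, coord_single_self]

theorem id_eq_cut_add_sum (S : Finset I) :
    ContinuousLinearMap.id k (A.apply W) =
      A.cut W S + ∑ i ∈ S, (A.single W i).comp (A.coord W i) := by
  rw [cut, sub_add_cancel]

end ReidSymbol

end

section

variable {k : Type u} [NontriviallyNormedField k]

/-! ### Operators from a bounded direct product to a completed direct sum -/

theorem exists_norm_smul_mem_Ioo (hk : DenseRange (fun x : k => ‖x‖₊)) {V : Ban k} {x : V}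
    (hx : x ≠ 0) {a b : ℝ} (ha : 0 ≤ a) (hab : a < b) : ∃ c : k, a < ‖c • x‖ ∧ ‖c • x‖ < b := by
  have hx' : 0 < ‖x‖ := norm_pos_iff.mpr hx
  obtain ⟨_, ⟨c, rfl⟩, h1, h2⟩ := Dense.exists_between hk
    (show Real.toNNReal (a / ‖x‖) < Real.toNNReal (b / ‖x‖) from
      (Real.toNNReal_lt_toNNReal_iff (div_pos (ha.trans_lt hab) hx')).mpr
        (div_lt_div_of_pos_right hab hx'))
  refine ⟨c, ?_, ?_⟩
  · rw [Real.toNNReal_lt_iff_lt_coe (by positivity), coe_nnnorm, div_lt_iff₀ hx'] at h1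
    rwa [norm_smul]
  · rw [Real.lt_toNNReal_iff_coe_lt, coe_nnnorm, lt_div_iff₀ hx'] at h2
    rwa [norm_smul]

theorem Ban.norm_sub_le_max {V : Ban k} (x y : V) : ‖x - y‖ ≤ max ‖x‖ ‖y‖ := by
  simpa [sub_eq_add_neg] using IsUltrametricDist.norm_add_le_max x (-y)

namespace ReidSymbol

variable {I J : Type u} {V : I → Ban k} {W : J → Ban k}

theorem finite_le_norm_coord (x : sigma.apply W) {ε : ℝ} (hε : 0 < ε) :
    {j | ε ≤ ‖sigma.coord W j x‖}.Finite := Ban.finite_le_norm_coord W x hε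

theorem exists_coord_eq (x : ∀ i, V i) {C : ℝ} (hC : 0 ≤ C) (h : ∀ i, ‖x i‖ ≤ C) :
    ∃ y : pi.apply V, (∀ i, pi.coord V i y = x i) ∧ ‖y‖ ≤ C := by
  obtain ⟨y, hy⟩ := Ban.exists_prodCoord_eq V x h
  refine ⟨y, hy, pi.norm_le_of_coord_le V hC fun i => ?_⟩
  exact (congrArg norm (hy i)).trans_le (h i)

/-- On the elements supported in `B`, all coordinates of `f` outside the finite set `S` have norm
at most `c`. -/
def BoundedOff (f : pi.apply V →L[k] sigma.apply W) (B : Set I) (S : Finset J) (c : ℝ) : Prop :=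
  ∀ x, (∀ i ∉ B, pi.coord V i x = 0) → ∀ j ∉ S, ‖sigma.coord W j (f x)‖ ≤ c * ‖x‖

/-- A gliding hump argument around the infimum `L` of the attainable bounds. If `L > 0`, vectors `z
n` of norm close to `1`, supported further and further out, have images exceeding `L` at distinct
coordinates `j n`. Their sum exists in the product, and its image has norm at least `L` at every `j
n`, so it does not vanish at infinity. -/
theorem exists_boundedOff_of_antitone (hk : DenseRange (fun x : k => ‖x‖₊))
    (f : pi.apply V →L[k] sigma.apply W) {B : ℕ → Set I} (hB : Antitone B)
    (hB' : ⋂ m, B m = ∅) {ε : ℝ} (hε : 0 < ε) : ∃ m S, BoundedOff f (B m) S ε := by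
  classical
  by_contra hneg
  let G : Set ℝ := {c | 0 ≤ c ∧ ∃ m S, BoundedOff f (B m) S c}
  have hmono : ∀ c ∈ G, ∀ d, c ≤ d → d ∈ G := by
    rintro c ⟨hc, m, S, h⟩ d hcd
    exact ⟨hc.trans hcd, m, S, fun x hx j hj => (h x hx j hj).trans (by gcongr)⟩
  have hf : ‖f‖ ∈ G := by
    refine ⟨norm_nonneg _, 0, ∅, fun x _ j _ => ?_⟩
    exact (ContinuousLinearMap.norm_apply_le_of_norm_le_one
      (sigma.norm_coord_le_one W j) _).trans (f.le_opNorm x)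
  have hbdd : BddBelow G := ⟨0, fun c hc => hc.1⟩
  obtain ⟨L, rfl⟩ : ∃ L, L = sInf G := ⟨_, rfl⟩
  have hεL : ε ≤ sInf G := le_csInf ⟨_, hf⟩ fun c hc => by
    by_contra! h
    exact hneg (hmono c hc ε h.le).2
  have hhi : ∀ c, sInf G < c → c ∈ G := fun c hc => by
    obtain ⟨d, hd, hdc⟩ := exists_lt_of_csInf_lt ⟨_, hf⟩ hc
    exact hmono d hd c hdc.le
  have hlo : ∀ c, 0 ≤ c → c < sInf G → ∀ m S, ¬ BoundedOff f (B m) S c := fun c hc hcL m S h =>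
    notMem_of_lt_csInf hcL hbdd ⟨hc, m, S, h⟩
  generalize sInf G = L at hεL hhi hlo
  have hL : 0 < L := hε.trans_le hεL
  let t : ℕ → ℝ := fun n => 1 + 1 / ((n : ℝ) + 1)
  have ht : StrictAnti t := fun a b hab => by
    have : (a : ℝ) < b := by exact_mod_cast hab
    exact add_lt_add_right (one_div_lt_one_div_of_lt (by positivity) (by linarith)) 1
  have ht1 : ∀ n, 1 < t n := fun n => lt_add_of_pos_right _ (by positivity)
  have ht0 : ∀ n, 0 < t n := fun n => zero_lt_one.trans (ht1 n)
  -- Each hump uses consecutive values of `t`: `z n` has norm between `t (3n+1)` and `t (3n)`, its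
  -- image exceeds `L * t (3n+2)` at `j n`, and the later humps have norm at most `t (3n+3)`. The
  -- bound here lies above `L`, hence is attainable; it keeps the image of the later humps at most
  -- `L * t (3n+2)` outside `S n`.
  have hhi' : ∀ n, ∃ m S, BoundedOff f (B m) S (L * t (3 * n + 2) / t (3 * n + 3)) := fun n => by
    refine (hhi _ ?_).2
    rw [lt_div_iff₀ (ht0 _)]
    exact mul_lt_mul_of_pos_left (ht (by lia)) hL
  choose m S hmS using hhi'
  -- A monotone majorant of both `n` and `m`: supports in `B (M n)` shrink to the empty set, and the
  -- tail after hump `n` lies in `B (m n)`.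
  let M : ℕ → ℕ := fun n => n + ∑ l ∈ Finset.range (n + 1), m l
  have hM : ∀ l n, l ≤ n → m l ≤ M n := fun l n hln =>
    (Finset.single_le_sum (f := m) (fun _ _ => Nat.zero_le _)
      (Finset.mem_range_succ_iff.mpr hln)).trans (Nat.le_add_left _ _)
  have hMn : ∀ n, n ≤ M n := fun n => Nat.le_add_right _ _
  have hMmono : Monotone M := fun a b hab => add_le_add hab
    (Finset.sum_le_sum_of_subset (Finset.range_mono (by lia)))
  have hstep : ∀ n (F : Finset J), ∃ (z : pi.apply V) (j : J),
      (∀ i ∉ B (M n), pi.coord V i z = 0) ∧ ‖z‖ < t (3 * n) ∧ j ∉ F ∧ j ∉ S n ∧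
        L * t (3 * n + 2) < ‖sigma.coord W j (f z)‖ := by
    intro n F
    -- This constant lies below `L`, so it is not attainable and a violating vector exists. Density
    -- of the value group lets it be rescaled into the narrow norm window.
    have h := hlo (L * t (3 * n + 2) / t (3 * n + 1))
      (div_nonneg (mul_nonneg hL.le (ht0 _).le) (ht0 _).le) (by
        rw [div_lt_iff₀ (ht0 _)]
        exact mul_lt_mul_of_pos_left (ht (by lia)) hL) (M n) (F ∪ S n)
    simp only [BoundedOff, not_forall, not_le, Finset.mem_union, not_or] at h
    obtain ⟨x, hx, j, ⟨hjF, hjS⟩, h⟩ := h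
    have hx0 : x ≠ 0 := by
      rintro rfl
      simp at h
    obtain ⟨c, hc1, hc2⟩ := exists_norm_smul_mem_Ioo hk hx0 (ht0 (3 * n + 1)).le
      (ht (Nat.lt_succ_self (3 * n)))
    have hc0 : 0 < ‖c‖ := by
      rw [norm_pos_iff]
      rintro rfl
      rw [zero_smul, norm_zero] at hc1
      exact hc1.not_gt (ht0 _)
    refine ⟨c • x, j, fun i hi => by rw [map_smul, hx i hi, smul_zero], hc2, hjF, hjS, ?_⟩
    rw [map_smul, map_smul, norm_smul]
    rw [norm_smul] at hc1
    calc L * t (3 * n + 2) = L * t (3 * n + 2) / t (3 * n + 1) * t (3 * n + 1) :=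
          (div_mul_cancel₀ _ (ht0 _).ne').symm
      _ ≤ L * t (3 * n + 2) / t (3 * n + 1) * (‖c‖ * ‖x‖) := by
          refine mul_le_mul_of_nonneg_left hc1.le ?_
          exact div_nonneg (mul_nonneg hL.le (ht0 _).le) (ht0 _).le
      _ = ‖c‖ * (L * t (3 * n + 2) / t (3 * n + 1) * ‖x‖) := by ring
      _ < ‖c‖ * ‖sigma.coord W j (f x)‖ := mul_lt_mul_of_pos_left h hc0
  choose Z jj hZsupp hZnorm hjF hjS hZ using hstep
  -- `F n` collects the finitely many coordinates where the image of an earlier hump has norm at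
  -- least `L`; the next coordinate avoids them.
  let F : ℕ → Finset J := fun n => Nat.rec ∅ (fun n F =>
    F ∪ (finite_le_norm_coord (f (Z n F)) hL).toFinset) n
  let z : ℕ → pi.apply V := fun n => Z n (F n)
  let j : ℕ → J := fun n => jj n (F n)
  have hF : ∀ n, F (n + 1) = F n ∪ (finite_le_norm_coord (f (z n)) hL).toFinset := fun n => rfl
  have hFmono : Monotone F := monotone_nat_of_le_succ fun n => by
    rw [hF]
    exact Finset.subset_union_left
  have hlarge : ∀ n, L * t (3 * n + 2) < ‖sigma.coord W (j n) (f (z n))‖ := fun n => hZ n (F n)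
  have hLt : ∀ n, L ≤ L * t n := fun n => le_mul_of_one_le_right hL.le (ht1 n).le
  have hsmall : ∀ l n, l < n → ‖sigma.coord W (j n) (f (z l))‖ < L := by
    intro l n hln
    by_contra! h
    refine hjF n (F n) (hFmono (Nat.succ_le_of_lt hln) ?_)
    rw [Nat.succ_eq_add_one, hF]
    exact Finset.mem_union_right _ ((Set.Finite.mem_toFinset _).mpr h)
  have hinj : Function.Injective j := by
    have : ∀ a b, a < b → j a ≠ j b := fun a b hab h => by
      have h1 := hsmall a b hab
      rw [← h] at h1
      exact (h1.trans_le (hLt _)).not_gt (hlarge a)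
    intro a b hab
    by_contra hne
    rcases lt_or_gt_of_ne hne with h | h
    · exact this a b h hab
    · exact this b a h hab.symm
  have hK : ∀ i, ∃ K, i ∉ B K := fun i => by
    by_contra! h
    exact Set.notMem_empty i (hB' ▸ Set.mem_iInter.mpr h)
  choose K hK using hK
  have hzero : ∀ i n, K i ≤ n → pi.coord V i (z n) = 0 := fun i n hn =>
    hZsupp n (F n) i fun h => hK i (hB (hn.trans (hMn n)) h)
  -- `y n` is the sum of all humps from `n` on. It is finite at each coordinate `i`, because `z l`
  -- vanishes there for `l ≥ K i`.
  have htail : ∀ n, ∃ y : pi.apply V,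
      (∀ i, pi.coord V i y = ∑ l ∈ Finset.Ico n (K i), pi.coord V i (z l)) ∧ ‖y‖ ≤ t (3 * n) := by
    refine fun n => exists_coord_eq _ (ht0 _).le fun i => ?_
    refine IsUltrametricDist.norm_sum_le_of_forall_le_of_nonneg (ht0 _).le fun l hl => ?_
    refine (ContinuousLinearMap.norm_apply_le_of_norm_le_one (pi.norm_coord_le_one V i) _).trans ?_
    refine (hZnorm l (F l)).le.trans (ht.antitone ?_)
    have := (Finset.mem_Ico.mp hl).1
    lia
  choose y hy hynorm using htail
  have hysucc : ∀ n, y n = z n + y (n + 1) := fun n => by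
    refine pi.ext V fun i => ?_
    rw [map_add, hy, hy]
    rcases lt_or_ge n (K i) with h | h
    · exact Finset.sum_eq_sum_Ico_succ_bot h _
    · rw [hzero i n h, Finset.Ico_eq_empty (by lia), Finset.Ico_eq_empty (by lia)]
      simp
  have hy0 : ∀ n, y 0 = ∑ l ∈ Finset.range n, z l + y n := fun n => by
    induction n with
    | zero => simp
    | succ n ih => rw [ih, Finset.sum_range_succ, add_assoc, ← hysucc]
  have hysupp : ∀ n i, i ∉ B (M n) → pi.coord V i (y n) = 0 := fun n i hi => by
    rw [hy]
    refine Finset.sum_eq_zero fun l hl => hZsupp l (F l) i fun h => hi ?_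
    exact hB (hMmono (Finset.mem_Ico.mp hl).1) h
  refine (Set.infinite_range_of_injective hinj)
    ((finite_le_norm_coord (f (y 0)) hL).subset ?_)
  rintro _ ⟨n, rfl⟩
  change L ≤ ‖sigma.coord W (j n) (f (y 0))‖
  have hd : ‖sigma.coord W (j n) (f (y (n + 1)))‖ ≤ L * t (3 * n + 2) := by
    refine (hmS n (y (n + 1)) (fun i hi => hysupp _ i fun h => hi (hB (hM n _ (by lia)) h)) _
      (hjS n (F n))).trans ?_
    calc L * t (3 * n + 2) / t (3 * n + 3) * ‖y (n + 1)‖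
        ≤ L * t (3 * n + 2) / t (3 * n + 3) * t (3 * n + 3) :=
          mul_le_mul_of_nonneg_left (hynorm (n + 1))
            (div_nonneg (mul_nonneg hL.le (ht0 _).le) (ht0 _).le)
      _ = L * t (3 * n + 2) := div_mul_cancel₀ _ (ht0 _).ne'
  have ha : ‖sigma.coord W (j n) (f (∑ l ∈ Finset.range n, z l))‖ ≤ L * t (3 * n + 2) := by
    rw [map_sum, map_sum]
    refine IsUltrametricDist.norm_sum_le_of_forall_le_of_nonneg
      (hL.le.trans (hLt _)) fun l hl => ?_
    exact (hsmall l n (Finset.mem_range.mp hl)).le.trans (hLt _)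
  have hsum : sigma.coord W (j n) (f (z n)) = sigma.coord W (j n) (f (y 0)) -
      (sigma.coord W (j n) (f (∑ l ∈ Finset.range n, z l)) +
        sigma.coord W (j n) (f (y (n + 1)))) := by
    rw [hy0 (n + 1), Finset.sum_range_succ]
    simp only [map_add]
    abel
  -- Earlier and later humps contribute at most `L * t (3n+2)` at `j n`, strictly less than hump
  -- `n`, so the ultrametric inequality prevents cancellation.
  have hmax : ‖sigma.coord W (j n) (f (z n))‖ ≤
      max ‖sigma.coord W (j n) (f (y 0))‖ (L * t (3 * n + 2)) := by
    rw [hsum]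
    refine (Ban.norm_sub_le_max _ _).trans (max_le_max le_rfl ?_)
    exact (IsUltrametricDist.norm_add_le_max _ _).trans (max_le ha hd)
  rcases le_max_iff.mp hmax with h | h
  · exact (hLt _).trans ((hlarge n).le.trans h)
  · exact absurd (hlarge n) h.not_gt

/-- The Chase lemma: up to an error of norm at most `ε`, an operator from a bounded direct product
over an index set of non-measurable size to a completed direct sum is concentrated on finitely many
factors and finitely many summands. -/
theorem exists_norm_cut_comp_cut_le (hk : DenseRange (fun x : k => ‖x‖₊))
    (hI : ¬ IsMeasurableSize ℵ₁ I) (f : pi.apply V →L[k] sigma.apply W) {ε : ℝ} (hε : 0 < ε) :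
    ∃ (S : Finset I) (T : Finset J),
      ‖(sigma.cut W T).comp (f.comp (pi.cut V S))‖ ≤ ε := by
  classical
  suffices h : ∃ (S : Finset I) (T : Finset J), BoundedOff f (Set.univ \ S) T ε by
    obtain ⟨S, T, h⟩ := h
    refine ⟨S, T, ContinuousLinearMap.opNorm_le_bound _ hε.le fun x => ?_⟩
    refine sigma.norm_le_of_coord_le W (by positivity) fun j => ?_
    rw [ContinuousLinearMap.comp_apply, ContinuousLinearMap.comp_apply]
    by_cases hj : j ∈ T
    · rw [coord_cut_of_mem _ _ hj, norm_zero]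
      positivity
    · rw [coord_cut_of_notMem _ _ hj]
      refine (h (pi.cut V S x) (fun i hi => pi.coord_cut_of_mem V ?_ x) j hj).trans ?_
      · simpa using hi
      · gcongr
        exact ContinuousLinearMap.norm_apply_le_of_norm_le_one (pi.norm_cut_le_one V S) x
  -- The sets over which the conclusion holds form an ideal; the gliding hump supplies its condition
  -- on decreasing sequences.
  refine ideal_univ_of_not_isMeasurableSize hI
    (fun A => ∃ (S : Finset I) (T : Finset J), BoundedOff f (A \ S) T ε) ?_ ?_ ?_ ?_
  · rintro A B hAB ⟨S, T, h⟩
    exact ⟨S, T, fun x hx => h x fun i hi => hx i fun hi' => hi ⟨hAB hi'.1, hi'.2⟩⟩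
  · rintro A B ⟨S, T, h⟩ ⟨S', T', h'⟩
    refine ⟨S ∪ S', T ∪ T', fun x hx j hj => ?_⟩
    rw [Finset.mem_union, not_or] at hj
    have hcoord : ∀ i, ‖pi.coord V i x‖ ≤ ‖x‖ := fun i =>
      ContinuousLinearMap.norm_apply_le_of_norm_le_one (pi.norm_coord_le_one V i) x
    -- `y` is the part of `x` supported on `A \ S`; what remains is supported on `B \ S'`.
    obtain ⟨y, hy, hynorm⟩ := exists_coord_eq (V := V)
      (fun i => if i ∈ A \ S then pi.coord V i x else 0) (norm_nonneg x) fun i => by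
        split_ifs
        · exact hcoord i
        · simp
    have hxy : ‖x - y‖ ≤ ‖x‖ :=
      (Ban.norm_sub_le_max _ _).trans (max_le le_rfl hynorm)
    have h1 := h y (fun i hi => by rw [hy, if_neg hi]) j hj.1
    have h2 := h' (x - y) (fun i hi => by
      rw [map_sub, hy]
      split_ifs with hiA
      · exact sub_self _
      · rw [sub_zero]
        refine hx i fun hi' => ?_
        simp only [Set.mem_sdiff, Set.mem_union, Finset.coe_union, not_or, SetLike.mem_coe,
          not_and, not_not] at hi hiA hi'
        rcases hi'.1 with h | h
        · exact hi'.2.1 (hiA h)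
        · exact hi'.2.2 (hi h)) j hj.2
    have h3 : sigma.coord W j (f x) = sigma.coord W j (f y) + sigma.coord W j (f (x - y)) := by
      rw [← map_add, ← map_add, add_sub_cancel]
    rw [h3]
    refine (IsUltrametricDist.norm_add_le_max _ _).trans (max_le (h1.trans ?_) (h2.trans ?_)) <;>
      gcongr
  · refine fun i => ⟨{i}, ∅, fun x hx j _ => ?_⟩
    have : x = 0 := pi.ext V fun l => by
      rw [map_zero]
      exact hx l (by simp)
    rw [this]
    simp
  · intro B hB hB'
    obtain ⟨m, T, h⟩ := exists_boundedOff_of_antitone hk f hB hB' hε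
    exact ⟨m, ∅, T, by simpa using h⟩

end ReidSymbol

end

section

variable {k : Type u} [NontriviallyNormedField k]

open ContinuousLinearMap

/-! ### Operators factoring approximately through a class of spaces -/

/-- The operators which differ by an operator of norm less than `1` from a finite sum of operators,
each the composite of two contractions through a member of the class `C`. -/
def nearFactor (C : Ban k → Prop) (X Y : Ban k) : AddSubmonoid (X →L[k] Y) :=
  AddSubmonoid.closure ({T | ‖T‖ < 1} ∪
    {T | ∃ V, C V ∧ ∃ (a : X →L[k] V) (b : V →L[k] Y), ‖a‖ ≤ 1 ∧ ‖b‖ ≤ 1 ∧ T = b.comp a})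

namespace nearFactor

variable {C D : Ban k → Prop} {X Y Z : Ban k}

theorem mem_of_norm_lt_one {T : X →L[k] Y} (h : ‖T‖ < 1) : T ∈ nearFactor C X Y :=
  AddSubmonoid.subset_closure (Or.inl h)

theorem comp_mem {V : Ban k} (hV : C V) {a : X →L[k] V} {b : V →L[k] Y} (ha : ‖a‖ ≤ 1)
    (hb : ‖b‖ ≤ 1) : b.comp a ∈ nearFactor C X Y :=
  AddSubmonoid.subset_closure (Or.inr ⟨V, hV, a, b, ha, hb, rfl⟩)

theorem induction {p : (X →L[k] Y) → Prop} (lt_one : ∀ T, ‖T‖ < 1 → p T)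
    (factor : ∀ V, C V → ∀ (a : X →L[k] V) (b : V →L[k] Y), ‖a‖ ≤ 1 → ‖b‖ ≤ 1 → p (b.comp a))
    (add : ∀ S T, p S → p T → p (S + T)) {T : X →L[k] Y} (hT : T ∈ nearFactor C X Y) : p T := by
  refine AddSubmonoid.closure_induction (fun T hT => ?_) (lt_one 0 (by simp))
    (fun S T _ _ hS hT => add S T hS hT) hT
  rcases hT with hT | ⟨V, hV, a, b, ha, hb, rfl⟩
  · exact lt_one T hT
  · exact factor V hV a b ha hb

theorem mono (h : ∀ V, C V → D V) {T : X →L[k] Y} (hT : T ∈ nearFactor C X Y) :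
    T ∈ nearFactor D X Y :=
  induction (p := fun T => T ∈ nearFactor D X Y) (fun _ => mem_of_norm_lt_one)
    (fun V hV _ _ ha hb => comp_mem (h V hV) ha hb) (fun _ _ => add_mem) hT

theorem comp_left {T : X →L[k] Y} (hT : T ∈ nearFactor C X Y) {b : Y →L[k] Z} (hb : ‖b‖ ≤ 1) :
    b.comp T ∈ nearFactor C X Z := by
  refine induction (p := fun T => b.comp T ∈ nearFactor C X Z) (fun T hT => ?_)
    (fun V hV a c ha hc => ?_) (fun S T hS hT => ?_) hT
  · exact mem_of_norm_lt_one ((opNorm_comp_le b T).trans_lt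
      ((mul_le_of_le_one_left (norm_nonneg _) hb).trans_lt hT))
  · exact comp_mem hV ha (norm_comp_le_one hb hc)
  · rw [comp_add]
    exact add_mem hS hT

theorem comp_right {T : Y →L[k] Z} (hT : T ∈ nearFactor C Y Z) {a : X →L[k] Y} (ha : ‖a‖ ≤ 1) :
    T.comp a ∈ nearFactor C X Z := by
  refine induction (p := fun T => T.comp a ∈ nearFactor C X Z) (fun T hT => ?_)
    (fun V hV b c hb hc => ?_) (fun S T hS hT => ?_) hT
  · exact mem_of_norm_lt_one ((opNorm_comp_le T a).trans_lt
      ((mul_le_of_le_one_right (norm_nonneg _) ha).trans_lt hT))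
  · exact comp_mem hV (norm_comp_le_one hb ha) hc
  · rw [add_comp]
    exact add_mem hS hT

/-- A larger cut absorbs a smaller one, so the finite sets found for the separate terms of a sum can
be replaced by their union. It thus suffices to treat contractions out of members of `C`. -/
theorem exists_cut_comp_mem {J : Type u} {A : ReidSymbol} {W : J → Ban k}
    (h : ∀ V, C V → ∀ f : V →L[k] A.apply W, ‖f‖ ≤ 1 →
      ∃ S, (A.cut W S).comp f ∈ nearFactor D V (A.apply W))
    {T : X →L[k] A.apply W} (hT : T ∈ nearFactor C X (A.apply W)) :
    ∃ S, (A.cut W S).comp T ∈ nearFactor D X (A.apply W) := by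
  classical
  refine induction (p := fun T => ∃ S, (A.cut W S).comp T ∈ nearFactor D X (A.apply W))
    (fun T hT => ⟨∅, comp_left (mem_of_norm_lt_one hT) (A.norm_cut_le_one W ∅)⟩)
    (fun V hV a b ha hb => ?_) ?_ hT
  · obtain ⟨S, hS⟩ := h V hV b hb
    exact ⟨S, comp_right hS ha⟩
  · rintro T₁ T₂ ⟨S₁, h₁⟩ ⟨S₂, h₂⟩
    refine ⟨S₁ ∪ S₂, ?_⟩
    rw [comp_add, ← A.cut_comp_cut W (Finset.subset_union_left (s₁ := S₁) (s₂ := S₂)), comp_assoc]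
    refine add_mem (comp_left h₁ (A.norm_cut_le_one W _)) ?_
    rw [A.cut_comp_cut W, ← A.cut_comp_cut W (Finset.subset_union_right (s₁ := S₁) (s₂ := S₂)),
      comp_assoc]
    · exact comp_left h₂ (A.norm_cut_le_one W _)
    · exact Finset.subset_union_left

theorem exists_comp_cut_mem {I : Type u} {A : ReidSymbol} {V : I → Ban k}
    (h : ∀ W, C W → ∀ f : A.apply V →L[k] W, ‖f‖ ≤ 1 →
      ∃ S, f.comp (A.cut V S) ∈ nearFactor D (A.apply V) W)
    {T : A.apply V →L[k] Y} (hT : T ∈ nearFactor C (A.apply V) Y) :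
    ∃ S, T.comp (A.cut V S) ∈ nearFactor D (A.apply V) Y := by
  classical
  refine induction (p := fun T => ∃ S, T.comp (A.cut V S) ∈ nearFactor D (A.apply V) Y)
    (fun T hT => ⟨∅, comp_right (mem_of_norm_lt_one hT) (A.norm_cut_le_one V ∅)⟩)
    (fun W hW a b ha hb => ?_) ?_ hT
  · obtain ⟨S, hS⟩ := h W hW a ha
    exact ⟨S, comp_left hS hb⟩
  · rintro T₁ T₂ ⟨S₁, h₁⟩ ⟨S₂, h₂⟩
    refine ⟨S₁ ∪ S₂, ?_⟩
    rw [add_comp]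
    refine add_mem ?_ ?_
    · rw [← A.cut_comp_cut' V (Finset.subset_union_left (s₁ := S₁) (s₂ := S₂)), ← comp_assoc]
      exact comp_right h₁ (A.norm_cut_le_one V _)
    · rw [← A.cut_comp_cut' V (Finset.subset_union_right (s₁ := S₁) (s₂ := S₂)), ← comp_assoc]
      exact comp_right h₂ (A.norm_cut_le_one V _)

end nearFactor

theorem Ban.IsReductiveSummand.id_mem_nearFactor {W V : Ban k} (h : W.IsReductiveSummand V)
    {C : Ban k → Prop} (hV : C V) : ContinuousLinearMap.id k W ∈ nearFactor C W W := by
  obtain ⟨σ, π, hσ, hπ, h⟩ := h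
  rw [← sub_add_cancel (ContinuousLinearMap.id k W) (π.comp σ)]
  exact add_mem (nearFactor.mem_of_norm_lt_one h) (nearFactor.comp_mem hV hσ hπ)

theorem Ban.Iso.exists_contractions {V W : Ban k} (h : V.Iso W) :
    ∃ (e : V →L[k] W) (e' : W →L[k] V), ‖e‖ ≤ 1 ∧ ‖e'‖ ≤ 1 ∧
      e'.comp e = ContinuousLinearMap.id k V ∧ e.comp e' = ContinuousLinearMap.id k W := by
  obtain ⟨e⟩ := h
  refine ⟨e.toLinearIsometry.toContinuousLinearMap, e.symm.toLinearIsometry.toContinuousLinearMap,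
    e.toLinearIsometry.norm_toContinuousLinearMap_le,
    e.symm.toLinearIsometry.norm_toContinuousLinearMap_le, ?_, ?_⟩ <;> ext x
  · exact e.symm_apply_apply x
  · exact e.apply_symm_apply x

end

/-! ### Stages of the pure Reid hierarchy -/

section

variable {k : Type u} [NontriviallyNormedField k] [CompleteSpace k] [IsUltrametricDist k]

open ContinuousLinearMap ReidSymbol

theorem Ban.finiteDimensional_base : FiniteDimensional k (Ban.base k) := Module.Finite.self k

theorem Ban.nontrivial_base : Nontrivial (Ban.base k) := inferInstanceAs (Nontrivial k)

/-- The union of the stages of index less than `α`. -/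
def PureStageLT (μ : Cardinal.{u}) (α : Ordinal.{u}) (A : ReidSymbol) (V : Ban k) : Prop :=
  ∃ γ < α, PureStage μ γ A V

/-- The union of the stages of index at most `α`. -/
def PureStageLE (μ : Cardinal.{u}) (α : Ordinal.{u}) (A : ReidSymbol) (V : Ban k) : Prop :=
  ∃ γ ≤ α, PureStage μ γ A V

theorem pureStage_zero_iff {μ : Cardinal.{u}} {A : ReidSymbol} {V : Ban k} :
    PureStage μ 0 A V ↔ V.Iso (Ban.base k) := by
  rw [PureStage]
  simp

theorem PureStage.exists_iso {μ : Cardinal.{u}} {α : Ordinal.{u}} {A : ReidSymbol} {V : Ban k}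
    (hV : PureStage μ α A V) (hα : α ≠ 0) :
    ∃ (I : Type u) (W : I → Ban k), #I < μ ∧
      (∀ i, ∃ C, PureStageLT μ α C (W i)) ∧
      (∀ β < α, {i | ∃ γ, β ≤ γ ∧ γ < α ∧ PureStage μ γ A.dual (W i)}.Infinite) ∧
      V.Iso (A.apply W) := by
  rw [PureStage] at hV
  obtain ⟨h, -⟩ | ⟨-, I, W, hI, hW, hinf, hiso⟩ := hV
  · exact absurd h hα
  · refine ⟨I, W, hI, fun i => ?_, fun β hβ => (hinf β hβ).mono ?_, hiso⟩
    · obtain ⟨γ, hγ, C, h⟩ := hW i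
      exact ⟨C, γ, hγ, h⟩
    · rintro i ⟨⟨γ, hγ, h⟩, hne⟩
      refine ⟨γ, ?_, hγ, h⟩
      by_contra! hlt
      exact hne ⟨γ, hlt, h⟩

/-- By the Chase lemma, only finitely many factors of `V` matter up to an error of norm at most
`1/2`. Factors of type Σ are already admissible; those of type Π have smaller stage and are treated
by induction, at the cost of further cuts. -/
theorem exists_cut_comp_mem_nearFactor (hk : DenseRange (fun x : k => ‖x‖₊)) {μ : Cardinal.{u}}
    (hμ : ∀ X : Type u, #X < μ → ¬ IsMeasurableSize ℵ₁ X) {J : Type u} (W : J → Ban k)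
    (γ : Ordinal.{u}) (hγ : γ ≠ 0) (V : Ban k) (hV : PureStage μ γ pi V)
    (f : V →L[k] sigma.apply W) (hf : ‖f‖ ≤ 1) :
    ∃ S, (sigma.cut W S).comp f ∈ nearFactor (PureStageLT μ γ sigma) V (sigma.apply W) := by
  classical
  induction γ using WellFoundedLT.induction generalizing V with
  | ind γ ih =>
    obtain ⟨I, U, hI, hU, -, hiso⟩ := hV.exists_iso hγ
    obtain ⟨e, e', he, he', hee, -⟩ := hiso.exists_contractions
    change V →L[k] pi.apply U at e
    obtain ⟨S, T, hST⟩ :=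
      exists_norm_cut_comp_cut_le hk (hμ I hI) (f.comp e') (one_half_pos (α := ℝ))
    have hmem : (sigma.cut W T).comp f ∈
        nearFactor (fun V => ∃ C, PureStageLT μ γ C V) V (sigma.apply W) := by
      have hf' : (sigma.cut W T).comp f =
          (((sigma.cut W T).comp ((f.comp e').comp (pi.cut U S))).comp e) +
          ∑ i ∈ S, ((sigma.cut W T).comp ((f.comp e').comp (pi.single U i))).comp
            ((pi.coord U i).comp e) := by
        have h := congrArg (fun g => (sigma.cut W T).comp ((f.comp e').comp (g.comp e)))
          (pi.id_eq_cut_add_sum U S)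
        have h1 : (f.comp e').comp ((ContinuousLinearMap.id k (pi.apply U)).comp e) = f := by
          rw [id_comp, comp_assoc, hee, comp_id]
        simp only [h1] at h
        rw [h]
        ext x
        simp
      rw [hf']
      refine add_mem (nearFactor.comp_right (nearFactor.mem_of_norm_lt_one
        (hST.trans_lt one_half_lt_one)) he) (sum_mem fun i _ => ?_)
      exact nearFactor.comp_mem (hU i) (norm_comp_le_one (pi.norm_coord_le_one U i) he)
        (norm_comp_le_one (sigma.norm_cut_le_one W T) (norm_comp_le_one
          (norm_comp_le_one hf he') (pi.norm_single_le_one U i)))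
    obtain ⟨S', hS'⟩ := nearFactor.exists_cut_comp_mem (D := PureStageLT μ γ sigma) (by
      rintro V ⟨C, δ, hδ, hV⟩ g hg
      have hsigma : PureStage μ δ sigma V → ∃ S, (sigma.cut W S).comp g ∈
          nearFactor (PureStageLT μ γ sigma) V (sigma.apply W) := fun h => by
        refine ⟨∅, ?_⟩
        rw [← comp_id ((sigma.cut W ∅).comp g)]
        exact nearFactor.comp_mem ⟨δ, hδ, h⟩ norm_id_le
          (norm_comp_le_one (sigma.norm_cut_le_one W ∅) hg)
      cases C with
      | sigma => exact hsigma hV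
      | pi =>
        -- The induction covers non-zero stages only; stage `0` is common to both types and counts
        -- as Σ.
        rcases eq_or_ne δ 0 with rfl | hδ0
        · exact hsigma (pureStage_zero_iff.mpr (pureStage_zero_iff.mp hV))
        · obtain ⟨S, hS⟩ := ih δ hδ hδ0 V hV g hg
          exact ⟨S, nearFactor.mono (fun _ ⟨ε, hε, h⟩ => ⟨ε, hε.trans hδ, h⟩) hS⟩) hmem
    refine ⟨S' ∪ T, ?_⟩
    have := nearFactor.comp_left hS' (sigma.norm_cut_le_one W (S' ∪ T))
    rwa [← comp_assoc, sigma.cut_comp_cut W Finset.subset_union_left, ← comp_assoc,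
      sigma.cut_comp_cut W Finset.subset_union_right] at this

/-- The mirror argument: cuts act on the source, and the finitely many relevant summands of `W` are
analysed. Only the index set of the source needs to be non-measurable. -/
theorem exists_comp_cut_mem_nearFactor (hk : DenseRange (fun x : k => ‖x‖₊)) {μ : Cardinal.{u}}
    {I : Type u} (hI : ¬ IsMeasurableSize ℵ₁ I) (V : I → Ban k)
    (γ : Ordinal.{u}) (hγ : γ ≠ 0) (W : Ban k) (hW : PureStage μ γ sigma W)
    (f : pi.apply V →L[k] W) (hf : ‖f‖ ≤ 1) :
    ∃ S, f.comp (pi.cut V S) ∈ nearFactor (PureStageLT μ γ pi) (pi.apply V) W := by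
  classical
  induction γ using WellFoundedLT.induction generalizing W with
  | ind γ ih =>
    obtain ⟨J, U, -, hU, -, hiso⟩ := hW.exists_iso hγ
    obtain ⟨e, e', he, he', hee, -⟩ := hiso.exists_contractions
    change W →L[k] sigma.apply U at e
    obtain ⟨S, T, hST⟩ :=
      exists_norm_cut_comp_cut_le hk hI (e.comp f) (one_half_pos (α := ℝ))
    have hmem : f.comp (pi.cut V S) ∈
        nearFactor (fun V => ∃ C, PureStageLT μ γ C V) (pi.apply V) W := by
      have hf' : f.comp (pi.cut V S) =
          e'.comp ((sigma.cut U T).comp ((e.comp f).comp (pi.cut V S))) +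
          ∑ j ∈ T, (e'.comp (sigma.single U j)).comp
            ((sigma.coord U j).comp ((e.comp f).comp (pi.cut V S))) := by
        have h := congrArg (fun g => e'.comp (g.comp ((e.comp f).comp (pi.cut V S))))
          (sigma.id_eq_cut_add_sum U T)
        have h1 : e'.comp ((ContinuousLinearMap.id k (sigma.apply U)).comp
            ((e.comp f).comp (pi.cut V S))) = f.comp (pi.cut V S) := by
          rw [id_comp, comp_assoc, ← comp_assoc, hee, id_comp]
        simp only [h1] at h
        rw [h]
        ext x
        simp
      rw [hf']
      refine add_mem (nearFactor.comp_left (nearFactor.mem_of_norm_lt_one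
        (hST.trans_lt one_half_lt_one)) he') (sum_mem fun j _ => ?_)
      exact nearFactor.comp_mem (hU j) (norm_comp_le_one (sigma.norm_coord_le_one U j)
        (norm_comp_le_one (norm_comp_le_one he hf) (pi.norm_cut_le_one V S)))
        (norm_comp_le_one he' (sigma.norm_single_le_one U j))
    obtain ⟨S', hS'⟩ := nearFactor.exists_comp_cut_mem (D := PureStageLT μ γ pi) (by
      rintro W ⟨C, δ, hδ, hW⟩ g hg
      have hpi : PureStage μ δ pi W → ∃ S, g.comp (pi.cut V S) ∈
          nearFactor (PureStageLT μ γ pi) (pi.apply V) W := fun h => by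
        refine ⟨∅, ?_⟩
        rw [← id_comp (g.comp (pi.cut V ∅))]
        exact nearFactor.comp_mem ⟨δ, hδ, h⟩ (norm_comp_le_one hg (pi.norm_cut_le_one V ∅))
          norm_id_le
      cases C with
      | pi => exact hpi hW
      | sigma =>
        rcases eq_or_ne δ 0 with rfl | hδ0
        · exact hpi (pureStage_zero_iff.mpr (pureStage_zero_iff.mp hW))
        · obtain ⟨S, hS⟩ := ih δ hδ hδ0 W hW g hg
          exact ⟨S, nearFactor.mono (fun _ ⟨ε, hε, h⟩ => ⟨ε, hε.trans hδ, h⟩) hS⟩) hmem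
    refine ⟨S' ∪ S, ?_⟩
    have := nearFactor.comp_right hS' (pi.norm_cut_le_one V (S' ∪ S))
    rwa [comp_assoc, pi.cut_comp_cut' V Finset.subset_union_left, comp_assoc,
      pi.cut_comp_cut' V Finset.subset_union_right] at this

/-- The spaces of the stages of `A.dual` up to `α` and of the stages of `A` below `α`. -/
def PureStageBelow (μ : Cardinal.{u}) (α : Ordinal.{u}) (A : ReidSymbol) (V : Ban k) : Prop :=
  PureStageLE μ α A.dual V ∨ PureStageLT μ α A V

/-- A dual stage `δ ≤ α` is traded for stages of `A` strictly below `δ`, so even the dual stage `α`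
itself drops below `α`. -/
theorem exists_cut_mem_nearFactor (hk : DenseRange (fun x : k => ‖x‖₊)) {μ : Cardinal.{u}}
    (hμ : ∀ X : Type u, #X < μ → ¬ IsMeasurableSize ℵ₁ X) {J : Type u}
    (hJ : ¬ IsMeasurableSize ℵ₁ J) (W : J → Ban k) {α : Ordinal.{u}} (hα : α ≠ 0) (A : ReidSymbol)
    (h : ContinuousLinearMap.id k (A.apply W) ∈
      nearFactor (PureStageBelow μ α A) (A.apply W) (A.apply W)) :
    ∃ S, A.cut W S ∈ nearFactor (PureStageLT μ α A) (A.apply W) (A.apply W) := by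
  have mono : ∀ δ ≤ α, ∀ V, PureStageLT μ δ A V → PureStageLT (k := k) μ α A V :=
    fun δ hδ V ⟨ε, hε, h⟩ => ⟨ε, hε.trans_le hδ, h⟩
  cases A with
  | sigma =>
    obtain ⟨S, hS⟩ := nearFactor.exists_cut_comp_mem (D := PureStageLT μ α sigma) (by
      intro V hV f hf
      have hlt : PureStageLT μ α sigma V → ∃ S, (sigma.cut W S).comp f ∈
          nearFactor (PureStageLT μ α sigma) V (sigma.apply W) := fun h => by
        refine ⟨∅, ?_⟩
        rw [← comp_id ((sigma.cut W ∅).comp f)]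
        exact nearFactor.comp_mem h norm_id_le (norm_comp_le_one (sigma.norm_cut_le_one W ∅) hf)
      rcases hV with ⟨δ, hδ, hV⟩ | hV
      · rcases eq_or_ne δ 0 with rfl | hδ0
        · exact hlt ⟨0, pos_iff_ne_zero.mpr hα,
            pureStage_zero_iff.mpr (pureStage_zero_iff.mp hV)⟩
        · obtain ⟨S, hS⟩ := exists_cut_comp_mem_nearFactor hk hμ W δ hδ0 V hV f hf
          exact ⟨S, nearFactor.mono (mono δ hδ) hS⟩
      · exact hlt hV) h
    exact ⟨S, by rwa [comp_id] at hS⟩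
  | pi =>
    obtain ⟨S, hS⟩ := nearFactor.exists_comp_cut_mem (D := PureStageLT μ α pi) (by
      intro V hV f hf
      have hlt : PureStageLT μ α pi V → ∃ S, f.comp (pi.cut W S) ∈
          nearFactor (PureStageLT μ α pi) (pi.apply W) V := fun h => by
        refine ⟨∅, ?_⟩
        rw [← id_comp (f.comp (pi.cut W ∅))]
        exact nearFactor.comp_mem h (norm_comp_le_one hf (pi.norm_cut_le_one W ∅)) norm_id_le
      rcases hV with ⟨δ, hδ, hV⟩ | hV
      · rcases eq_or_ne δ 0 with rfl | hδ0
        · exact hlt ⟨0, pos_iff_ne_zero.mpr hα,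
            pureStage_zero_iff.mpr (pureStage_zero_iff.mp hV)⟩
        · obtain ⟨S, hS⟩ := exists_comp_cut_mem_nearFactor hk hJ W δ hδ0 V hV f hf
          exact ⟨S, nearFactor.mono (mono δ hδ) hS⟩
      · exact hlt hV) h
    exact ⟨S, by rwa [id_comp] at hS⟩

/-- Only finitely many spaces occur in the sum, so their stages have a maximum below `α`, even when
`α` is a limit. -/
theorem exists_mem_nearFactor_pureStageLE {μ : Cardinal.{u}} {α : Ordinal.{u}} (hα : α ≠ 0)
    {A : ReidSymbol} {X Y : Ban k} {T : X →L[k] Y} (hT : T ∈ nearFactor (PureStageLT μ α A) X Y) :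
    ∃ γ < α, T ∈ nearFactor (PureStageLE μ γ A) X Y := by
  refine nearFactor.induction (p := fun T => ∃ γ < α, T ∈ nearFactor (PureStageLE μ γ A) X Y)
    (fun T hT => ⟨0, pos_iff_ne_zero.mpr hα, nearFactor.mem_of_norm_lt_one hT⟩) ?_ ?_ hT
  · rintro V ⟨γ, hγ, hV⟩ a b ha hb
    exact ⟨γ, hγ, nearFactor.comp_mem ⟨γ, le_rfl, hV⟩ ha hb⟩
  · rintro S T ⟨γ, hγ, hS⟩ ⟨δ, hδ, hT⟩
    refine ⟨max γ δ, max_lt hγ hδ, add_mem (nearFactor.mono ?_ hS) (nearFactor.mono ?_ hT)⟩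
    · exact fun V ⟨ε, hε, h⟩ => ⟨ε, hε.trans (le_max_left _ _), h⟩
    · exact fun V ⟨ε, hε, h⟩ => ⟨ε, hε.trans (le_max_right _ _), h⟩

theorem exists_finiteDimensional_range_of_mem_nearFactor {μ : Cardinal.{u}} {A : ReidSymbol}
    {X Y : Ban k} {T : X →L[k] Y} (hT : T ∈ nearFactor (PureStageLE μ 0 A) X Y) :
    ∃ T' : X →L[k] Y, FiniteDimensional k (LinearMap.range T'.toLinearMap) ∧ ‖T - T'‖ < 1 := by
  refine nearFactor.induction (p := fun T => ∃ T' : X →L[k] Y,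
    FiniteDimensional k (LinearMap.range T'.toLinearMap) ∧ ‖T - T'‖ < 1)
    (fun T hT => ⟨0, ?_, by simpa using hT⟩) ?_ ?_ hT
  · rw [toLinearMap_zero, LinearMap.range_zero]
    infer_instance
  · rintro V ⟨γ, hγ, hV⟩ a b ha hb
    obtain rfl : γ = 0 := nonpos_iff_eq_zero.mp hγ
    refine ⟨b.comp a, ?_, by simp⟩
    obtain ⟨e⟩ := pureStage_zero_iff.mp hV
    have := Ban.finiteDimensional_base (k := k)
    have : FiniteDimensional k V := Module.Finite.equiv e.symm.toLinearEquiv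
    have hle : LinearMap.range (b.comp a).toLinearMap ≤ LinearMap.range b.toLinearMap := by
      rintro _ ⟨x, rfl⟩
      exact ⟨a x, rfl⟩
    exact Submodule.finiteDimensional_of_le hle
  · rintro S T ⟨S', hS', hS⟩ ⟨T', hT', hT⟩
    refine ⟨S' + T', ?_, ?_⟩
    · refine Submodule.finiteDimensional_of_le (S₂ :=
        LinearMap.range S'.toLinearMap ⊔ LinearMap.range T'.toLinearMap) ?_
      rintro _ ⟨x, rfl⟩
      exact Submodule.add_mem_sup ⟨x, rfl⟩ ⟨x, rfl⟩
    · rw [add_sub_add_comm]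
      exact (opNorm_add_le_max _ _).trans_lt (max_lt hS hT)

/-- A finite-rank operator at distance less than `1` from the cut would be injective on the vectors
fixed by the cut, and these include independent vectors from infinitely many factors. -/
theorem cut_notMem_nearFactor_zero {μ : Cardinal.{u}} {A B : ReidSymbol} {J : Type u}
    {W : J → Ban k} {s : Set J} (hs : s.Infinite) (hW : ∀ j ∈ s, (W j).Iso (Ban.base k))
    {S : Finset J} (hsS : ∀ j ∈ s, j ∉ S) :
    A.cut W S ∉ nearFactor (PureStageLE μ 0 B) (A.apply W) (A.apply W) := by
  classical
  intro h
  obtain ⟨T, hT, hnorm⟩ := exists_finiteDimensional_range_of_mem_nearFactor h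
  have hinj : ∀ x, A.cut W S x = x → T x = 0 → x = 0 := by
    intro x hx hTx
    by_contra hx0
    have h1 := (A.cut W S - T).le_opNorm x
    rw [sub_apply, hx, hTx, sub_zero] at h1
    exact (mul_lt_of_lt_one_left (norm_pos_iff.mpr hx0) hnorm).not_ge h1
  have hne : ∀ j : s, ∃ x : W j, x ≠ 0 := fun j => by
    obtain ⟨e⟩ := hW j j.2
    have := Ban.nontrivial_base (k := k)
    have := e.toEquiv.nontrivial
    exact exists_ne 0
  choose x hx using hne
  let v : s → A.apply W := fun j => A.single W j (x j)
  have hv : ∀ j, A.cut W S (v j) = v j := fun j => by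
    refine A.ext W fun i => ?_
    by_cases hi : i ∈ S
    · rw [A.coord_cut_of_mem W hi, A.coord_single_of_ne]
      rintro rfl
      exact hsS _ j.2 hi
    · rw [A.coord_cut_of_notMem W hi]
  let w : s → LinearMap.range T.toLinearMap := fun j => ⟨T (v j), v j, rfl⟩
  have hli : LinearIndependent k w := by
    rw [linearIndependent_iff']
    intro F g hg j hj
    have h1 : T (∑ i ∈ F, g i • v i) = 0 := by
      have := congrArg Subtype.val hg
      simpa [w] using this
    have h2 := hinj _ (by simp [hv]) h1
    have h3 := congrArg (A.coord W j) h2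
    rw [map_sum, Finset.sum_eq_single_of_mem j hj, map_smul, A.coord_single_self, map_zero,
      smul_eq_zero] at h3
    · exact h3.resolve_right (hx j)
    · intro i _ hij
      rw [map_smul, A.coord_single_of_ne W (fun h => hij (Subtype.ext h.symm)), smul_zero]
  have : Infinite s := hs.to_subtype
  exact not_finite_iff_infinite.mpr this hli.finite_of_isNoetherian

/-- No space of the stage `α` of `A` is, up to an error of norm less than `1`, a summand of a finite
direct sum of spaces of the stages of `A.dual` up to `α` and of the stages of `A` below `α`. -/
theorem id_notMem_nearFactor_pureStageBelow (hk : DenseRange (fun x : k => ‖x‖₊))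
    {α : Ordinal.{u}} (hα : α ≠ 0) {A : ReidSymbol} {μ ν : Cardinal.{u}}
    (hμ : ∀ X : Type u, #X < μ → ¬ IsMeasurableSize ℵ₁ X)
    (hν : ∀ X : Type u, #X < ν → ¬ IsMeasurableSize ℵ₁ X)
    {X : Ban k} (hX : PureStage μ α A X) :
    ContinuousLinearMap.id k X ∉ nearFactor (PureStageBelow ν α A) X X := by
  induction α using WellFoundedLT.induction generalizing A X with
  | ind α ih =>
    intro hid
    obtain ⟨J, W, hJ, -, hinf, hiso⟩ := hX.exists_iso hα
    obtain ⟨e, e', he, he', -, hee⟩ := hiso.exists_contractions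
    have hid' := nearFactor.comp_left (nearFactor.comp_right hid he') he
    rw [id_comp, hee] at hid'
    obtain ⟨S, hS⟩ := exists_cut_mem_nearFactor hk hν (hμ J hJ) W hα A hid'
    obtain ⟨γ, hγ, hS⟩ := exists_mem_nearFactor_pureStageLE hα hS
    -- The coordinates that survive the cut and are of dual type with stage in `[γ, α)`; the
    -- definition of the hierarchy provides infinitely many.
    let s : Set J := {j | ∃ δ, γ ≤ δ ∧ δ < α ∧ PureStage μ δ A.dual (W j)} \ S
    have hs : s.Infinite := (hinf γ hγ).sdiff S.finite_toSet
    have hdual : A.dual.dual = A := by cases A <;> rfl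
    have hzero : ∀ j ∈ s, γ = 0 ∧ (W j).Iso (Ban.base k) := by
      rintro j ⟨⟨δ, hγδ, hδ, hj⟩, hjS⟩
      rcases eq_or_ne δ 0 with rfl | hδ0
      · exact ⟨nonpos_iff_eq_zero.mp hγδ, pureStage_zero_iff.mp hj⟩
      · refine absurd ?_ (ih δ hδ hδ0 hj)
        -- Compressing the cut to coordinate `j` gives the identity of `W j`, now factored through
        -- stages of `A` at most `γ ≤ δ`, which the induction hypothesis for `A.dual` forbids.
        have h := nearFactor.comp_left (nearFactor.comp_right hS (A.norm_single_le_one W j))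
          (A.norm_coord_le_one W j)
        rw [A.coord_comp_cut_comp_single W hjS] at h
        refine nearFactor.mono (fun V hV => Or.inl ?_) h
        rw [hdual]
        obtain ⟨ε, hε, hV⟩ := hV
        exact ⟨ε, hε.trans hγδ, hV⟩
    obtain ⟨j, hj⟩ := hs.nonempty
    obtain rfl := (hzero j hj).1
    exact cut_notMem_nearFactor_zero hs (fun j hj => (hzero j hj).2) (fun j hj => hj.2) hS

/-! ### Deduction of the two inequalities -/

theorem not_isMeasurableSize_of_lt {κ : WithTop Cardinal.{u}} (hκ : NonMeasurabilityCondition κ)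
    {μ : Cardinal.{u}} (hμ : κ = μ ∨ κ = ⊤) (X : Type u) (hX : #X < μ) :
    ¬ IsMeasurableSize ℵ₁ X := by
  refine hκ X ?_
  rcases hμ with rfl | rfl
  · exact WithTop.coe_lt_coe.mpr hX
  · exact WithTop.coe_lt_top _

/-- Both halves of the theorem are instances, with `A` equal to Σ or Π. When `κ` is the class of all
cardinals the two spaces may come from different cardinals `μ` and `ν`, hence the two cardinals in
`id_notMem_nearFactor_pureStageBelow`. -/
theorem not_isReductiveSummand_of_le (hk : DenseRange (fun x : k => ‖x‖₊))
    {κ : WithTop Cardinal.{u}} (hκ : NonMeasurabilityCondition κ) {α β : Ordinal.{u}} (hβ : β ≠ 0)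
    (hαβ : α ≤ β) {A : ReidSymbol} {V W : Ban k} (hV : PureClass A.dual κ α V)
    (hW : PureClass A κ β W) : ¬ W.IsReductiveSummand V := by
  obtain ⟨ν, hν, hV⟩ := hV
  obtain ⟨μ, hμ, hW⟩ := hW
  exact fun h => id_notMem_nearFactor_pureStageBelow hk hβ (not_isMeasurableSize_of_lt hκ hμ)
    (not_isMeasurableSize_of_lt hκ hν) hW (h.id_mem_nearFactor (Or.inl ⟨α, hαβ, hV⟩))

end

theorem mainTheorem3 {k : Type u} [NontriviallyNormedField k] [CompleteSpace k]
    [IsUltrametricDist k] (hk : DenseRange (fun x : k => ‖x‖₊))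
    (κ : WithTop Cardinal.{u}) (hκ : ((ℵ₀ : Cardinal.{u}) : WithTop Cardinal.{u}) ≤ κ)
    (hmeas : NonMeasurabilityCondition κ)
    (α β : Ordinal.{u}) (hα : α ≠ 0) (hβ : β ≠ 0)
    (V W : Ban k) (hV : PPi κ α V) (hW : PSig κ β W) :
    (W.IsReductiveSummand V → β < α) ∧ (V.IsReductiveSummand W → α < β) := by
  constructor
  · intro h
    by_contra! hle
    exact not_isReductiveSummand_of_le (A := .sigma) hk hmeas hβ hle hV hW h
  · intro h
    by_contra! hle
    exact not_isReductiveSummand_of_le (A := .pi) hk hmeas hα hle hW hV h
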